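/- Write $[n]=\{1,\dots,n\}$, let $\binom{[n]}{j}$ be the family of all $j$-element subsets of $[n]$, and for a family $\mathcal F$ of sets put $\mathcal D(\mathcal F)=\{F\setminus F' : F,F'\in\mathcal F\}$. A family $\mathcal F$ is called $t$-intersecting if $|F\cap F'|\ge t$ for all $F,F'\in\mathcal F$. Let $k\ge 3$ and $1\le t\le k-1$ be integers. Then there exists a $t$-intersecting family $\mathcal F\subset\binom{[2k-t+1]}{k}$ such that $$\bigcup_{j=0}^{k-t}\binom{[2k-2t+2]}{j}\subset\mathcal D(\mathcal F).$$ -/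

import Mathlib

open scoped FinsetFamily

/-- A family `F` of finite sets is `t`-intersecting if any two members share at least `t` elements. -/
def IsTIntersecting {α : Type*} [DecidableEq α] (t : ℕ) (F : Finset (Finset α)) : Prop :=
  ∀ A ∈ F, ∀ B ∈ F, t ≤ (A ∩ B).card

/-- The family of difference sets `D(F) = {A \ B : A, B ∈ F}`. -/
def diffFamily {α : Type*} [DecidableEq α] (F : Finset (Finset α)) : Finset (Finset α) :=
  F \\ F

/-! Adding `t - 1` common points to an intersecting family changes no difference, so `t ≤ k - 2`
reduces to `t = 1` with `k - t + 1 ≥ 3` in place of `k`; `t = k - 1` has its own small family. For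
`t = 1`, choose one set from each complementary pair of `k`-subsets of a `2k`-set: the choice is
automatically intersecting, and `exists_sdiff_eq_of_selfDual` gives all differences once every
`(k-1)`-set has supersets of both kinds.

For odd `k`, choose the sets of odd trace on a fixed `k`-set. For even `k`, single out a point and
split the rest into `P`, `Q` of sizes `k - 1`, `k`; a colouring of the `(k-1)`-subsets of `P ∪ Q`
decides the sets through the point, and duality the others. Odd trace on `P` fails only at `P`
itself, whose complement offers only sets of trace zero. Uncolouring `P` then spoils each `P \ {p}`,
which is repaired by colouring one further superset of it. -/

/-- If a self-dual colouring `c` of the `k`-subsets of a `2k`-set `V` is not constant on the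
supersets of any `(k-1)`-set, then every set of size less than `k` is a difference of two
members of the colour class of `c`. -/
lemma exists_sdiff_eq_of_selfDual {α : Type*} [DecidableEq α] {V : Finset α} {k : ℕ}
    (hk : 1 ≤ k) (hV : V.card = 2 * k) {c : Finset α → Prop}
    (hdual : ∀ A ⊆ V, A.card = k → (c (V \ A) ↔ ¬ c A))
    (hmix : ∀ D ⊆ V, D.card + 1 = k →
      (∃ x ∈ V \ D, c (insert x D)) ∧ ∃ x ∈ V \ D, ¬ c (insert x D))
    {D : Finset α} (hD : D ⊆ V) (hDk : D.card < k) :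
    ∃ A B, (A ⊆ V ∧ A.card = k ∧ c A) ∧ (B ⊆ V ∧ B.card = k ∧ c B) ∧ A \ B = D := by
  obtain ⟨D', hDD', hD'V, hD'⟩ :=
    Finset.exists_subsuperset_card_eq (n := k - 1) hD (by omega) (by omega)
  obtain ⟨⟨x, hx, hcx⟩, y, hy, hcy⟩ := hmix D' hD'V (by omega)
  rw [Finset.mem_sdiff] at hx hy
  have hxV : insert x D' ⊆ V := Finset.insert_subset hx.1 hD'V
  have hyV : insert y D' ⊆ V := Finset.insert_subset hy.1 hD'V
  have hxk : (insert x D').card = k := by rw [Finset.card_insert_of_notMem hx.2]; omega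
  have hyk : (insert y D').card = k := by rw [Finset.card_insert_of_notMem hy.2]; omega
  -- The empty set is separate: `J` would need `k` points, but only `k - 1` remain outside `D' ∪ {x,
  -- y}`.
  rcases Nat.eq_zero_or_pos D.card with h0 | hpos
  · rw [Finset.card_eq_zero] at h0
    exact ⟨insert x D', insert x D', ⟨hxV, hxk, hcx⟩, ⟨hxV, hxk, hcx⟩, by simp [h0]⟩
  have hxyV : insert x (insert y D') ⊆ V := Finset.insert_subset hx.1 hyV
  have hxyk : (insert x (insert y D')).card ≤ k + 1 := by
    have := Finset.card_insert_le x (insert y D'); omega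
  obtain ⟨J, hJ, hJk⟩ := Finset.exists_subset_card_eq
    (s := V \ insert x (insert y D')) (n := k - D.card)
    (by rw [Finset.card_sdiff_of_subset hxyV]; omega)
  have hJ' : ∀ z ∈ J, z ∈ V ∧ z ≠ x ∧ z ≠ y ∧ z ∉ D' := by
    intro z hz
    have := hJ hz
    simp only [Finset.mem_sdiff, Finset.mem_insert, not_or] at this
    tauto
  have hBV : D ∪ J ⊆ V := Finset.union_subset hD fun z hz => (hJ' z hz).1
  have hBk : (D ∪ J).card = k := by
    rw [Finset.card_union_of_disjoint]
    · omega
    · rw [Finset.disjoint_left]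
      exact fun z hz hz' => (hJ' z hz').2.2.2 (hDD' hz)
  have compl_card : ∀ A ⊆ V, A.card = k → (V \ A).card = k := fun A hA hAk => by
    rw [Finset.card_sdiff_of_subset hA]; omega
  -- Subtracting a complement is intersecting, and `D ∪ J` meets both `insert x D'` and `insert y
  -- D'` exactly in `D`.
  by_cases hB : c (D ∪ J)
  · refine ⟨D ∪ J, V \ insert y D', ⟨hBV, hBk, hB⟩,
      ⟨Finset.sdiff_subset, compl_card _ hyV hyk, (hdual _ hyV hyk).2 hcy⟩, ?_⟩
    ext z
    have h1 := @hD z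
    have h2 := @hDD' z
    have h3 := hJ' z
    simp only [Finset.mem_sdiff, Finset.mem_union, Finset.mem_insert]
    tauto
  · refine ⟨insert x D', V \ (D ∪ J), ⟨hxV, hxk, hcx⟩,
      ⟨Finset.sdiff_subset, compl_card _ hBV hBk, (hdual _ hBV hBk).2 hB⟩, ?_⟩
    ext z
    have h1 := @hxV z
    have h2 := @hDD' z
    have h3 := hJ' z
    simp only [Finset.mem_sdiff, Finset.mem_union, Finset.mem_insert] at h1 ⊢
    tauto

/-! ### Perturbed parity colouring -/

/-- The sets of odd trace on `P`, with `P` itself removed and each `P \ {p} ∪ {y p}` added. -/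
def PerturbedOdd {α : Type*} [DecidableEq α] (P : Finset α) (y : α → α) (B : Finset α) : Prop :=
  B ≠ P ∧ (Odd (B ∩ P).card ∨ ∃ p ∈ P, B = insert (y p) (P.erase p))

section PerturbedOdd

variable {α : Type*} [DecidableEq α] {P Q : Finset α} {y : α → α}

lemma insert_erase_inter_self {p : α} (hp : y p ∉ P) :
    insert (y p) (P.erase p) ∩ P = P.erase p := by
  ext z
  simp only [Finset.mem_inter, Finset.mem_insert, Finset.mem_erase]
  constructor
  · rintro ⟨rfl | h, h'⟩
    · exact absurd h' hp
    · exact h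
  · exact fun h => ⟨Or.inr h, h.2⟩

/-- Every added set has trace of size `|P| - 1`, so excluding that size leaves only parity to check.
-/
lemma not_perturbedOdd (hy : ∀ p ∈ P, y p ∉ P) {B : Finset α}
    (hB : ¬ Odd (B ∩ P).card) (hB' : (B ∩ P).card + 1 ≠ P.card) : ¬ PerturbedOdd P y B := by
  rintro ⟨-, h | ⟨p, hp, rfl⟩⟩
  · exact hB h
  · rw [insert_erase_inter_self (hy p hp), Finset.card_erase_add_one hp] at hB'
    exact hB' rfl

lemma perturbedOdd_of_card_lt {B : Finset α}
    (hB : Odd (B ∩ P).card) (hB' : (B ∩ P).card < P.card) : PerturbedOdd P y B := by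
  refine ⟨?_, Or.inl hB⟩
  rintro rfl
  simp at hB'

lemma card_inter_add_card_inter (hPQ : Disjoint P Q) {E : Finset α} (hE : E ⊆ P ∪ Q) :
    (E ∩ P).card + (E ∩ Q).card = E.card := by
  rw [← Finset.card_union_of_disjoint
    (hPQ.mono Finset.inter_subset_right Finset.inter_subset_right),
    ← Finset.inter_union_distrib_left, Finset.inter_eq_left.2 hE]

lemma card_insert_inter_of_mem {E : Finset α} {p : α} (hp : p ∈ P) (hpE : p ∉ E) :
    (insert p E ∩ P).card = (E ∩ P).card + 1 := by
  rw [Finset.insert_inter_of_mem hp, Finset.card_insert_of_notMem]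
  exact fun h => hpE (Finset.mem_inter.1 h).1

/-- Each set of size `|P| - 1` has supersets of size `|P|` of both kinds. -/
lemma exists_insert_perturbedOdd (hPQ : Disjoint P Q) (hP : Odd P.card)
    (hQ : Q.card = P.card + 1) (hy : ∀ p ∈ P, y p ∈ Q) (hinj : Set.InjOn y P)
    {E : Finset α} (hE : E ⊆ P ∪ Q) (hEc : E.card + 1 = P.card) :
    (∃ x ∈ (P ∪ Q) \ E, PerturbedOdd P y (insert x E)) ∧
      ∃ x ∈ (P ∪ Q) \ E, ¬ PerturbedOdd P y (insert x E) := by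
  have hyP : ∀ p ∈ P, y p ∉ P := fun p hp h => Finset.disjoint_left.1 hPQ h (hy p hp)
  have hsum := card_inter_add_card_inter hPQ hE
  have memP : ∀ p ∈ P, p ∉ E → p ∈ (P ∪ Q) \ E := fun p hp hpE => by simp [hp, hpE]
  have memQ : ∀ q ∈ Q, q ∉ E → q ∈ (P ∪ Q) \ E := fun q hq hqE => by simp [hq, hqE]
  have cardPE : (P \ E).card + (E ∩ P).card = P.card := by
    rw [Finset.inter_comm]; exact Finset.card_sdiff_add_card_inter P E
  have cardQE : (Q \ E).card + (E ∩ Q).card = Q.card := by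
    rw [Finset.inter_comm]; exact Finset.card_sdiff_add_card_inter Q E
  obtain ⟨p, hp⟩ : (P \ E).Nonempty := Finset.card_pos.1 (by omega)
  obtain ⟨q, hq⟩ : (Q \ E).Nonempty := Finset.card_pos.1 (by omega)
  rw [Finset.mem_sdiff] at hp hq
  have hqP : q ∉ P := fun h => Finset.disjoint_left.1 hPQ h hq.1
  by_cases ha : (E ∩ P).card = E.card
  · have hEP : E ⊆ P := by
      rw [← Finset.inter_eq_left]
      exact Finset.eq_of_subset_of_card_le Finset.inter_subset_left ha.ge
    have hpE : insert p E = P := Finset.eq_of_subset_of_card_le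
      (Finset.insert_subset hp.1 hEP) (by rw [Finset.card_insert_of_notMem hp.2]; omega)
    have hE' : P.erase p = E := by rw [← hpE, Finset.erase_insert hp.2]
    have hyE : y p ∉ E := fun h => hyP p hp.1 (hEP h)
    refine ⟨⟨y p, memQ _ (hy p hp.1) hyE, ?_, Or.inr ⟨p, hp.1, by rw [hE']⟩⟩,
      p, memP p hp.1 hp.2, fun h => h.1 hpE⟩
    intro h
    exact hyP p hp.1 (h ▸ Finset.mem_insert_self _ _)
  have hqc : (insert q E ∩ P).card = (E ∩ P).card := by rw [Finset.insert_inter_of_notMem hqP]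
  by_cases hodd : Odd (E ∩ P).card
  · refine ⟨⟨q, memQ q hq.1 hq.2, perturbedOdd_of_card_lt (by rwa [hqc]) (by omega)⟩, ?_⟩
    obtain ⟨p', hp', hne⟩ : ∃ p' ∈ P \ E, p' ≠ p :=
      Finset.exists_mem_ne (by omega) p
    rw [Finset.mem_sdiff] at hp'
    -- Inserting `p` or `p'` makes the trace even, so both results would be added sets with the same
    -- point of `Q`; injectivity of `y` forbids this.
    by_contra! hcon
    have key : ∀ r ∈ P, r ∉ E → ∃ s ∈ P, insert r E = insert (y s) (P.erase s) := by
      intro r hr hrE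
      rcases (hcon r (memP r hr hrE)).2 with h | h
      · rw [card_insert_inter_of_mem hr hrE, Nat.odd_add_one] at h
        exact absurd hodd h
      · exact h
    obtain ⟨s, hs, hse⟩ := key p hp.1 hp.2
    obtain ⟨s', hs', hse'⟩ := key p' hp'.1 hp'.2
    have hys : y s ∈ E := by
      have : y s ∈ insert p E := hse ▸ Finset.mem_insert_self _ _
      rcases Finset.mem_insert.1 this with h | h
      · exact absurd (h ▸ hp.1) (hyP s hs)
      · exact h
    have hss : y s = y s' := by
      have : y s ∈ insert (y s') (P.erase s') := hse' ▸ Finset.mem_insert_of_mem hys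
      rcases Finset.mem_insert.1 this with h | h
      · exact h
      · exact absurd (Finset.mem_of_mem_erase h) (hyP s hs)
    obtain rfl := hinj hs hs' hss
    have : p' ∈ insert p E := by rw [hse, ← hse']; exact Finset.mem_insert_self _ _
    rcases Finset.mem_insert.1 this with h | h
    · exact hne h
    · exact hp'.2 h
  · have hpc := card_insert_inter_of_mem hp.1 hp.2
    refine ⟨⟨p, memP p hp.1 hp.2, perturbedOdd_of_card_lt ?_ (by omega)⟩,
      q, memQ q hq.1 hq.2, not_perturbedOdd hyP (by rwa [hqc]) ?_⟩
    · rwa [hpc, Nat.odd_add_one]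
    · rw [Nat.not_odd_iff_even] at hodd
      obtain ⟨u, hu⟩ := hP
      obtain ⟨v, hv⟩ := hodd
      omega

/-- A set `D` of size `|P|` and the subsets of size `|P|` of its complement are not all of
opposite kinds. -/
lemma exists_erase_perturbedOdd_iff (hPQ : Disjoint P Q) (hP : Odd P.card) (hP3 : 3 ≤ P.card)
    (hQ : Q.card = P.card + 1) (hy : ∀ p ∈ P, y p ∈ Q)
    {D : Finset α} (hD : D ⊆ P ∪ Q) (hDc : D.card = P.card) :
    ∃ z ∈ (P ∪ Q) \ D, (PerturbedOdd P y (((P ∪ Q) \ D).erase z) ↔ PerturbedOdd P y D) := by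
  have hyP : ∀ p ∈ P, y p ∉ P := fun p hp h => Finset.disjoint_left.1 hPQ h (hy p hp)
  have hsum := card_inter_add_card_inter hPQ hD
  set G := (P ∪ Q) \ D with hG
  have hGP : G ∩ P = P \ D := by ext z; simp [hG]; tauto
  have hGQ : G ∩ Q = Q \ D := by ext z; simp [hG]; tauto
  have cardP : (G ∩ P).card + (D ∩ P).card = P.card := by
    rw [hGP, Finset.inter_comm]; exact Finset.card_sdiff_add_card_inter P D
  have cardQ : (G ∩ Q).card + (D ∩ Q).card = Q.card := by
    rw [hGQ, Finset.inter_comm]; exact Finset.card_sdiff_add_card_inter Q D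
  have hDP : (D ∩ P).card = P.card → D = P := fun h => by
    have h1 : D ∩ P = P := Finset.eq_of_subset_of_card_le Finset.inter_subset_right h.ge
    exact (Finset.eq_of_subset_of_card_le (Finset.inter_eq_right.1 h1) hDc.le).symm
  have eraseP : ∀ p ∈ G ∩ P, (G.erase p ∩ P).card + 1 = (G ∩ P).card := fun p hp => by
    rw [Finset.erase_inter, Finset.card_erase_add_one hp]
  have eraseQ : ∀ q ∈ G ∩ Q, (G.erase q ∩ P).card = (G ∩ P).card := fun q hq => by
    rw [Finset.erase_inter, Finset.erase_eq_of_notMem]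
    exact fun h => Finset.disjoint_left.1 hPQ (Finset.mem_inter.1 h).2 (Finset.mem_inter.1 hq).2
  obtain ⟨u, hu⟩ := hP
  by_cases hh : PerturbedOdd P y D
  · simp only [hh, iff_true]
    rcases hh with ⟨hne, hodd | ⟨p, hp, rfl⟩⟩
    · obtain ⟨v, hv⟩ := hodd
      have : (D ∩ P).card ≠ P.card := fun h => hne (hDP h)
      obtain ⟨z, hz⟩ : (G ∩ P).Nonempty := Finset.card_pos.1 (by omega)
      have := eraseP z hz
      exact ⟨z, (Finset.mem_inter.1 hz).1,
        perturbedOdd_of_card_lt ⟨u - v - 1, by omega⟩ (by omega)⟩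
    · rw [insert_erase_inter_self (hyP p hp), Finset.card_erase_of_mem hp] at cardP hsum
      obtain ⟨z, hz⟩ : (G ∩ Q).Nonempty := Finset.card_pos.1 (by omega)
      have := eraseQ z hz
      exact ⟨z, (Finset.mem_inter.1 hz).1, perturbedOdd_of_card_lt ⟨0, by omega⟩ (by omega)⟩
  · simp only [hh, iff_false]
    -- Here the complement is `Q`, so all candidates have trace zero: this is why `P` must be
    -- uncoloured.
    by_cases hDeq : D = P
    · have hc : (D ∩ P).card = P.card := by simp [hDeq]
      obtain ⟨z, hz⟩ : (G ∩ Q).Nonempty := Finset.card_pos.1 (by omega)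
      have := eraseQ z hz
      have h0 : (G.erase z ∩ P).card = 0 := by omega
      exact ⟨z, (Finset.mem_inter.1 hz).1, not_perturbedOdd hyP (by rw [h0]; exact Nat.not_odd_zero) (by omega)⟩
    have heven : ¬ Odd (D ∩ P).card := fun h => hh ⟨hDeq, Or.inl h⟩
    rw [Nat.not_odd_iff_even] at heven
    obtain ⟨v, hv⟩ := heven
    -- If `D ⊆ Q`, then `G` is `P` plus one point of `Q`; dropping that point leaves the uncoloured
    -- set `P`.
    by_cases hv0 : v = 0
    · obtain ⟨z, hz⟩ : (G ∩ Q).Nonempty := Finset.card_pos.1 (by omega)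
      refine ⟨z, (Finset.mem_inter.1 hz).1, fun h => h.1 ?_⟩
      have hz' := eraseQ z hz
      have h1 : G.erase z ∩ P = P :=
        Finset.eq_of_subset_of_card_le Finset.inter_subset_right (by omega)
      refine (Finset.eq_of_subset_of_card_le (Finset.inter_eq_right.1 h1) ?_).symm
      rw [Finset.card_erase_of_mem (Finset.mem_inter.1 hz).1, hG, Finset.card_sdiff_of_subset hD,
        Finset.card_union_of_disjoint hPQ]
      omega
    · obtain ⟨z, hz⟩ : (G ∩ P).Nonempty := Finset.card_pos.1 (by omega)
      have := eraseP z hz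
      refine ⟨z, (Finset.mem_inter.1 hz).1, not_perturbedOdd hyP ?_ (by omega)⟩
      rw [Nat.not_odd_iff_even]
      exact ⟨u - v, by omega⟩

end PerturbedOdd

/-! ### Self-dual colourings -/

/-- A self-dual colouring of the `k`-subsets of a `2k`-set, for `k` odd. -/
lemma exists_selfDual_of_odd {k : ℕ} (hk : Odd k) :
    ∃ c : Finset ℕ → Prop,
      (∀ A ⊆ Finset.Icc 1 (2 * k), A.card = k → (c (Finset.Icc 1 (2 * k) \ A) ↔ ¬ c A)) ∧
      ∀ D ⊆ Finset.Icc 1 (2 * k), D.card + 1 = k →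
        (∃ x ∈ Finset.Icc 1 (2 * k) \ D, c (insert x D)) ∧
          ∃ x ∈ Finset.Icc 1 (2 * k) \ D, ¬ c (insert x D) := by
  have hPc : (Finset.Icc 1 k).card = k := by simp
  have hQc : (Finset.Icc (k + 1) (2 * k)).card = k := by simp; omega
  refine ⟨fun A => Odd (A ∩ Finset.Icc 1 k).card, fun A hA hAk => ?_, fun D hD hDk => ?_⟩
  · have h1 : (Finset.Icc 1 (2 * k) \ A) ∩ Finset.Icc 1 k = Finset.Icc 1 k \ A := by
      ext z
      simp only [Finset.mem_inter, Finset.mem_sdiff, Finset.mem_Icc]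
      constructor
      · tauto
      · rintro ⟨h, h'⟩
        exact ⟨⟨⟨h.1, by omega⟩, h'⟩, h⟩
    have h2 := Finset.card_sdiff_add_card_inter (Finset.Icc 1 k) A
    rw [Finset.inter_comm, hPc] at h2
    beta_reduce
    rw [h1]
    rw [← h2, Nat.odd_add'] at hk
    rw [← Nat.not_even_iff_odd (n := (Finset.Icc 1 k \ A).card), ← hk]
  · obtain ⟨p, hp, hpD⟩ := Finset.exists_mem_notMem_of_card_lt_card
      -- `D` is too small to cover either half, and a new point from one half flips the parity while
      -- one from the other keeps it.
      (s := D) (t := Finset.Icc 1 k) (by omega)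
    obtain ⟨q, hq, hqD⟩ := Finset.exists_mem_notMem_of_card_lt_card
      (s := D) (t := Finset.Icc (k + 1) (2 * k)) (by omega)
    have hpV : p ∈ Finset.Icc 1 (2 * k) \ D := by
      simp only [Finset.mem_sdiff, Finset.mem_Icc] at hp ⊢
      exact ⟨by omega, hpD⟩
    have hqV : q ∈ Finset.Icc 1 (2 * k) \ D := by
      simp only [Finset.mem_sdiff, Finset.mem_Icc] at hq ⊢
      exact ⟨by omega, hqD⟩
    have hqP : q ∉ Finset.Icc 1 k := by
      simp only [Finset.mem_Icc] at hq ⊢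
      omega
    beta_reduce
    have hpc := card_insert_inter_of_mem hp hpD
    have hqc : (insert q D ∩ Finset.Icc 1 k).card = (D ∩ Finset.Icc 1 k).card := by
      rw [Finset.insert_inter_of_notMem hqP]
    by_cases hodd : Odd (D ∩ Finset.Icc 1 k).card
    · exact ⟨⟨q, hqV, by rwa [hqc]⟩, p, hpV, by rwa [hpc, Nat.odd_add_one, not_not]⟩
    · exact ⟨⟨p, hpV, by rwa [hpc, Nat.odd_add_one]⟩, q, hqV, by rwa [hqc]⟩

/-- A self-dual colouring of the `k`-subsets of a `2k`-set, for `k` even. -/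
lemma exists_selfDual_of_even {k : ℕ} (hk : Even k) (hk3 : 3 ≤ k) :
    ∃ c : Finset ℕ → Prop,
      (∀ A ⊆ Finset.Icc 1 (2 * k), A.card = k → (c (Finset.Icc 1 (2 * k) \ A) ↔ ¬ c A)) ∧
      ∀ D ⊆ Finset.Icc 1 (2 * k), D.card + 1 = k →
        (∃ x ∈ Finset.Icc 1 (2 * k) \ D, c (insert x D)) ∧
          ∃ x ∈ Finset.Icc 1 (2 * k) \ D, ¬ c (insert x D) := by
  classical
  obtain ⟨P, hPdef⟩ : ∃ P, P = Finset.Icc 1 (k - 1) := ⟨_, rfl⟩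
  obtain ⟨Q, hQdef⟩ : ∃ Q, Q = Finset.Icc k (2 * k - 1) := ⟨_, rfl⟩
  obtain ⟨V, hVdef⟩ : ∃ V, V = Finset.Icc 1 (2 * k) := ⟨_, rfl⟩
  have hPc : P.card = k - 1 := by simp [hPdef]
  have hQc : Q.card = k := by simp [hQdef]; omega
  have hPodd : Odd P.card := by
    obtain ⟨u, hu⟩ := hk
    exact ⟨u - 1, by omega⟩
  have hPQ : Disjoint P Q := by
    rw [Finset.disjoint_left]
    intro z hz hz'
    simp only [hPdef, hQdef, Finset.mem_Icc] at hz hz'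
    omega
  have hV : V = insert (2 * k) (P ∪ Q) := by
    ext z
    simp only [hPdef, hQdef, hVdef, Finset.mem_insert, Finset.mem_union, Finset.mem_Icc]
    omega
  have hkPQ : 2 * k ∉ P ∪ Q := by
    simp only [hPdef, hQdef, Finset.mem_union, Finset.mem_Icc]
    omega
  have hy : ∀ p ∈ P, p + k ∈ Q := fun p hp => by
    simp only [hPdef, hQdef, Finset.mem_Icc] at hp ⊢
    omega
  have hinj : Set.InjOn (fun p => p + k) (P : Set ℕ) := fun a _ b _ h => by simpa using h
  rw [← hVdef]
  clear hPdef hQdef hVdef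
  set h := PerturbedOdd P (fun p => p + k) with hh
  have hkV : 2 * k ∈ V := by rw [hV]; exact Finset.mem_insert_self _ _
  refine ⟨fun A => if 2 * k ∈ A then h (A.erase (2 * k)) else ¬ h ((V \ A).erase (2 * k)),
    fun A hA hAk => ?_, fun D hD hDk => ?_⟩
  · by_cases hm : 2 * k ∈ A
    · simp [hm, Finset.inter_eq_right.2 hA]
    · simp [hm, hkV]
  by_cases hm : 2 * k ∈ D
  · have hE : D.erase (2 * k) ⊆ P ∪ Q := by
      rw [← Finset.subset_insert_iff, ← hV]; exact hD
    obtain ⟨⟨a, ha, ha'⟩, b, hb, hb'⟩ := exists_insert_perturbedOdd hPQ hPodd (by omega) hy hinj hE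
      (by rw [Finset.card_erase_of_mem hm]; omega)
    have key : ∀ z ∈ (P ∪ Q) \ D.erase (2 * k), z ∈ V \ D ∧
        (insert z D).erase (2 * k) = insert z (D.erase (2 * k)) := by
      intro z hz
      rw [Finset.mem_sdiff] at hz
      have hne : z ≠ 2 * k := fun e => hkPQ (e ▸ hz.1)
      refine ⟨?_, Finset.erase_insert_of_ne hne⟩
      rw [Finset.mem_sdiff, hV]
      exact ⟨Finset.mem_insert_of_mem hz.1, fun hzD => hz.2 (Finset.mem_erase.2 ⟨hne, hzD⟩)⟩
    beta_reduce
    refine ⟨⟨a, (key a ha).1, ?_⟩, b, (key b hb).1, ?_⟩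
    · rw [if_pos (Finset.mem_insert_of_mem hm), (key a ha).2]; exact ha'
    · rw [if_pos (Finset.mem_insert_of_mem hm), (key b hb).2]; exact hb'
  · have hDPQ : D ⊆ P ∪ Q := by
      rw [hV, Finset.subset_insert_iff_of_notMem hm] at hD; exact hD
    obtain ⟨z, hz, hiff⟩ := exists_erase_perturbedOdd_iff hPQ hPodd (by
      obtain ⟨u, hu⟩ := hk
      omega) (by omega) hy hDPQ (by omega)
    have hz' := Finset.mem_sdiff.1 hz
    have hne : 2 * k ≠ z := fun e => hkPQ (e ▸ hz'.1)
    have hzV : z ∈ V \ D := by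
      rw [Finset.mem_sdiff, hV]; exact ⟨Finset.mem_insert_of_mem hz'.1, hz'.2⟩
    have hG : (V \ insert z D).erase (2 * k) = ((P ∪ Q) \ D).erase z := by
      ext w
      have : w ∈ P ∪ Q → w ≠ 2 * k := fun hw e => hkPQ (e ▸ hw)
      simp only [hV, Finset.mem_erase, Finset.mem_sdiff, Finset.mem_insert]
      tauto
    have hmz : 2 * k ∉ insert z D := by simp [hne, hm]
    have hx : 2 * k ∈ V \ D := Finset.mem_sdiff.2 ⟨hkV, hm⟩
    beta_reduce
    by_cases hd : h D
    · refine ⟨⟨2 * k, hx, ?_⟩, z, hzV, ?_⟩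
      · rw [if_pos (Finset.mem_insert_self _ _), Finset.erase_insert hm]; exact hd
      · rw [if_neg hmz, hG, not_not]; exact hiff.2 hd
    · refine ⟨⟨z, hzV, ?_⟩, 2 * k, hx, ?_⟩
      · rw [if_neg hmz, hG]; exact fun e => hd (hiff.1 e)
      · rw [if_pos (Finset.mem_insert_self _ _), Finset.erase_insert hm]; exact hd

/-! ### The families -/

/-- The case `t = 1`: an intersecting family of `k`-subsets of a `2k`-set with all differences
of size less than `k`. -/
lemma exists_intersecting_forall_exists_sdiff {k : ℕ} (hk : 3 ≤ k) :
    ∃ F : Finset (Finset ℕ),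
      F ⊆ Finset.powersetCard k (Finset.Icc 1 (2 * k)) ∧
      IsTIntersecting 1 F ∧
      ∀ D ⊆ Finset.Icc 1 (2 * k), D.card < k → ∃ A ∈ F, ∃ B ∈ F, A \ B = D := by
  classical
  obtain ⟨c, hdual, hmix⟩ := (Nat.even_or_odd k).elim
    (fun h => exists_selfDual_of_even h hk) exists_selfDual_of_odd
  refine ⟨(Finset.powersetCard k (Finset.Icc 1 (2 * k))).filter c, Finset.filter_subset _ _,
    fun A hA B hB => ?_, fun D hD hDk => ?_⟩
  · simp only [Finset.mem_filter, Finset.mem_powersetCard] at hA hB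
    obtain ⟨⟨hAV, hAk⟩, hA⟩ := hA
    obtain ⟨⟨hBV, hBk⟩, hB⟩ := hB
    by_contra hlt
    have h0 : Disjoint A B := by
      rw [Finset.disjoint_iff_inter_eq_empty, ← Finset.card_eq_zero]; omega
    have hBA : B = Finset.Icc 1 (2 * k) \ A := by
      refine Finset.eq_of_subset_of_card_le (Finset.subset_sdiff.2 ⟨hBV, h0.symm⟩) ?_
      rw [Finset.card_sdiff_of_subset hAV, Nat.card_Icc]
      omega
    exact (hdual A hAV hAk).1 (hBA ▸ hB) hA
  · obtain ⟨A, B, hA, hB, h⟩ :=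
      exists_sdiff_eq_of_selfDual (by omega) (by simp) hdual hmix hD hDk
    refine ⟨A, ?_, B, ?_, h⟩ <;> simp only [Finset.mem_filter, Finset.mem_powersetCard] <;> tauto

/-- The case `t = k - 1`: the members are the complements of the pairs `{5, x}` with `x ≤ 4`. -/
lemma exists_family_of_codim_one {k : ℕ} (hk : 3 ≤ k) :
    ∃ F : Finset (Finset ℕ),
      F ⊆ Finset.powersetCard k (Finset.Icc 1 (k + 2)) ∧
      IsTIntersecting (k - 1) F ∧
      ∀ D ⊆ Finset.Icc 1 4, D.card ≤ 1 → ∃ A ∈ F, ∃ B ∈ F, A \ B = D := by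
  refine ⟨(Finset.Icc 1 4).image fun x => Finset.Icc 1 (k + 2) \ {5, x}, ?_, ?_, ?_⟩
  · intro A hA
    obtain ⟨x, hx, rfl⟩ := Finset.mem_image.1 hA
    rw [Finset.mem_Icc] at hx
    rw [Finset.mem_powersetCard, Finset.card_sdiff_of_subset, Finset.card_pair (by omega)]
    · exact ⟨Finset.sdiff_subset, by simp⟩
    · intro z hz
      simp only [Finset.mem_insert, Finset.mem_singleton, Finset.mem_Icc] at hz ⊢
      omega
  · intro A hA B hB
    obtain ⟨x, hx, rfl⟩ := Finset.mem_image.1 hA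
    obtain ⟨y, hy, rfl⟩ := Finset.mem_image.1 hB
    rw [← Finset.sdiff_union_distrib]
    have h1 := Finset.le_card_sdiff ({5, x} ∪ {5, y}) (Finset.Icc 1 (k + 2))
    have h2 : ({5, x} ∪ {5, y} : Finset ℕ).card ≤ 3 := by
      rw [show ({5, x} ∪ {5, y} : Finset ℕ) = {5, x, y} by ext; simp]
      exact Finset.card_le_three
    rw [Nat.card_Icc] at h1
    omega
  · intro D hD hDc
    rcases Nat.lt_or_ge D.card 1 with h0 | h1
    · rw [Nat.lt_one_iff, Finset.card_eq_zero] at h0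
      exact ⟨_, Finset.mem_image_of_mem _ (show 1 ∈ Finset.Icc 1 4 by simp), _,
        Finset.mem_image_of_mem _ (show 1 ∈ Finset.Icc 1 4 by simp), by simp [h0]⟩
    · obtain ⟨x, rfl⟩ := Finset.card_eq_one.1 (le_antisymm hDc h1)
      have hx := Finset.singleton_subset_iff.1 hD
      obtain ⟨y, hy, hyx⟩ : ∃ y ∈ Finset.Icc 1 4, y ≠ x := Finset.exists_mem_ne (by simp) x
      refine ⟨_, Finset.mem_image_of_mem _ hy, _, Finset.mem_image_of_mem _ hx, ?_⟩
      rw [Finset.mem_Icc] at hx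
      ext z
      simp only [Finset.mem_sdiff, Finset.mem_insert, Finset.mem_singleton, Finset.mem_Icc]
      omega

theorem mainTheorem4 (k t : ℕ) (hk : 3 ≤ k) (ht : 1 ≤ t) (htk : t ≤ k - 1) :
    ∃ F : Finset (Finset ℕ),
      F ⊆ Finset.powersetCard k (Finset.Icc 1 (2 * k - t + 1)) ∧
      IsTIntersecting t F ∧
      (Finset.range (k - t + 1)).biUnion
          (fun j => Finset.powersetCard j (Finset.Icc 1 (2 * k - 2 * t + 2))) ⊆ diffFamily F := by
  suffices ∃ F : Finset (Finset ℕ),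
      F ⊆ Finset.powersetCard k (Finset.Icc 1 (2 * k - t + 1)) ∧ IsTIntersecting t F ∧
      ∀ D ⊆ Finset.Icc 1 (2 * k - 2 * t + 2), D.card ≤ k - t → ∃ A ∈ F, ∃ B ∈ F, A \ B = D by
    obtain ⟨F, hF, hint, hdiff⟩ := this
    refine ⟨F, hF, hint, fun D hD => ?_⟩
    simp only [Finset.mem_biUnion, Finset.mem_range, Finset.mem_powersetCard] at hD
    obtain ⟨j, hj, hDV, hDc⟩ := hD
    exact Finset.mem_diffs.2 (hdiff D hDV (by omega))
  -- For `t = k - 1` the reduction would need intersecting pairs in a 4-set; these form part of a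
  -- star or a triangle and miss a singleton difference.
  rcases htk.eq_or_lt with rfl | hlt
  · rw [show 2 * k - (k - 1) + 1 = k + 2 by omega, show 2 * k - 2 * (k - 1) + 2 = 4 by omega,
      show k - (k - 1) = 1 by omega]
    exact exists_family_of_codim_one hk
  obtain ⟨F, hF, hint, hdiff⟩ :=
    exists_intersecting_forall_exists_sdiff (k := k - t + 1) (by omega)
  rw [show 2 * (k - t + 1) = 2 * k - 2 * t + 2 by omega] at hF hdiff
  obtain ⟨T, hT⟩ : ∃ T, T = Finset.Icc (2 * k - 2 * t + 3) (2 * k - t + 1) := ⟨_, rfl⟩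
  have hTc : T.card = t - 1 := by rw [hT, Nat.card_Icc]; omega
  have hFT : ∀ A ∈ F, Disjoint A T := by
    intro A hA
    rw [Finset.disjoint_left]
    intro z hz hzT
    have := (Finset.mem_powersetCard.1 (hF hA)).1 hz
    simp only [hT, Finset.mem_Icc] at this hzT
    omega
  refine ⟨F.image (· ∪ T), ?_, ?_, fun D hD hDc => ?_⟩
  · intro A hA
    obtain ⟨A, hA', rfl⟩ := Finset.mem_image.1 hA
    obtain ⟨hAV, hAc⟩ := Finset.mem_powersetCard.1 (hF hA')
    rw [Finset.mem_powersetCard]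
    refine ⟨Finset.union_subset (hAV.trans ?_) ?_, ?_⟩
    · exact Finset.Icc_subset_Icc_right (by omega)
    · rw [hT]; exact Finset.Icc_subset_Icc_left (by omega)
    · rw [Finset.card_union_of_disjoint (hFT A hA')]; omega
  · intro A hA B hB
    obtain ⟨A, hA', rfl⟩ := Finset.mem_image.1 hA
    obtain ⟨B, hB', rfl⟩ := Finset.mem_image.1 hB
    have := hint A hA' B hB'
    rw [← Finset.inter_union_distrib_right, Finset.card_union_of_disjoint
      ((hFT A hA').mono_left Finset.inter_subset_left)]
    omega
  · obtain ⟨A, hA, B, hB, rfl⟩ := hdiff D hD (by omega)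
    refine ⟨_, Finset.mem_image_of_mem _ hA, _, Finset.mem_image_of_mem _ hB, ?_⟩
    ext z
    have : z ∈ A → z ∉ T := fun h => Finset.disjoint_left.1 (hFT A hA) h
    simp only [Finset.mem_sdiff, Finset.mem_union]
    tauto
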